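/- Let $d\in\mathbb N$ and let $\mathscr S=\mathscr S(\mathbb R^d)$ be the space of real-valued Schwartz functions on $\mathbb R^d$. Let $b\in\mathbb R$, $\sigma^2\ge 0$, and let $\nu$ be a $\sigma$-finite Borel measure on $\mathbb R\setminus\{0\}$ with $\int_{\mathbb R\setminus\{0\}}\min\{1,s^2\}\,\nu(\mathrm ds)<\infty$; put $$\psi(t)=ibt-\frac{\sigma^2t^2}{2}+\int_{\mathbb R\setminus\{0\}}\bigl(e^{its}-1-its\,\mathbf 1_{\{|s|\le 1\}}(s)\bigr)\,\nu(\mathrm ds),\qquad t\in\mathbb R.$$ Let $Z=(Z(f))_{f\in\mathscr S}$ be a Lévy noise field with characteristic triplet $(b,\sigma^2,\nu)$ on a probability space $(\Omega,\mathfrak A,\mathbf P)$: the $Z(f)$ are real random variables, $Z(\alpha f+\beta g)=\alpha Z(f)+\beta Z(g)$ almost surely for all $f,g\in\mathscr S$ and $\alpha,\beta\in\mathbb R$, $Z(f)\to Z(f_0)$ in probability whenever $f\to f_0$ in $\mathscr S$, and for every $f\in\mathscr S$ the function $\psi\circ f$ is integrable on $\mathbb R^d$ with $$\mathbb E\bigl[e^{iZ(f)}\bigr]=\exp\Bigl(\int_{\mathbb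 R^d}\psi(f(x))\,\mathrm dx\Bigr).$$ Assume moreover that $Z$ is continuous as a map from $\mathscr S$, equipped with the norm $(\|f\|_{L^1(\mathbb R^d)}^2+\|f\|_{L^2(\mathbb R^d)}^2)^{1/2}$, to the real random variables with convergence in probability. Suppose that the integrals $$b_1:=\int_{\{|s|>1\}}s\,\nu(\mathrm ds)\qquad\text{and}\qquad b_n:=\int_{\mathbb R\setminus\{0\}}s^n\,\nu(\mathrm ds)\quad(n\ge 2)$$ exist and are finite (that is, converge absolutely). Set $c_1:=b+b_1$, $c_2:=\sigma^2+b_2$ and $c_n:=b_n$ for $n\ge 3$. Then $Z(f)$ has moments of all orders, $\mathbb E[|Z(f)|^n]<\infty$ for all $f\in\mathscr S$ and all $n\in\mathbb N$, and for all $n\in\mathbb N$ and $f_1,\dots,f_n\in\mathscr S$ the product $\prod_{j=1}^nZ(f_j)$ is integrable and $$\mathbb E\Bigl[\prod_{j=1}^nZ(f_j)\Bigr]=\sum_{I\in\mathscr P^{(n)}}\ \prod_{B\in I}\Bigl(c_{|B|}\int_{\mathbb R^d}\prod_{j\in B}f_j(x)\,\mathrm dx\Bigr),$$ where $\mathscr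 P^{(n)}$ is the set of all partitions of $\{1,\dots,n\}$ into pairwise disjoint non-empty sets. -/

import Mathlib

open MeasureTheory Filter Topology Finset
open scoped SchwartzMap

noncomputable section

/-- A characteristic triplet `(b, σ², ν)`. The Lévy measure `ν`, a Borel measure on `ℝ ∖ {0}`, is
represented as a Borel measure on `ℝ` without mass at the origin; hence integrals over `ℝ ∖ {0}`
are integrals over `ℝ`. -/
structure LevyTriplet where
  /-- the drift `b` -/
  b : ℝ
  /-- the Gaussian variance `σ²` -/
  sigmaSq : ℝ
  /-- the Lévy measure `ν` -/
  ν : Measure ℝ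
  sigmaSq_nonneg : 0 ≤ sigmaSq
  sigmaFinite : SigmaFinite ν
  measure_zero : ν {0} = 0
  integrable_min : Integrable (fun s : ℝ => min 1 (s ^ 2)) ν

namespace LevyTriplet

/-- The Lévy characteristic
`ψ(t) = i b t - σ² t² / 2 + ∫ (exp (i t s) - 1 - i t s 1_{|s| ≤ 1}) ν(ds)`. -/
def psi (T : LevyTriplet) (t : ℝ) : ℂ :=
  Complex.I * T.b * t - T.sigmaSq * t ^ 2 / 2 +
    ∫ s : ℝ, (Complex.exp (Complex.I * t * s) - 1 -
      Complex.I * t * ({r : ℝ | |r| ≤ 1}.indicator (fun r => r) s : ℝ)) ∂T.ν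

/-- `b₁ = ∫_{|s| > 1} s ν(ds)` and `bₙ = ∫ sⁿ ν(ds)` for `n ≥ 2` (the value at `0` is never used). -/
def levyMoment (T : LevyTriplet) (n : ℕ) : ℝ :=
  if n = 1 then ∫ s in {s : ℝ | 1 < |s|}, s ∂T.ν else ∫ s : ℝ, s ^ n ∂T.ν

/-- `c₁ = b + b₁`, `c₂ = σ² + b₂` and `cₙ = bₙ` for `n ≥ 3` (the value at `0` is never used). -/
def c (T : LevyTriplet) (n : ℕ) : ℝ :=
  if n = 1 then T.b + T.levyMoment 1
  else if n = 2 then T.sigmaSq + T.levyMoment 2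
  else T.levyMoment n

end LevyTriplet

/-- A generalized random field indexed by a real topological vector space `V`: a family of
real random variables, almost surely linear in the index and continuous in probability. -/
structure IsGeneralizedRandomField {V Ω : Type*} [AddCommGroup V] [Module ℝ V]
    [TopologicalSpace V] [MeasurableSpace Ω] (P : Measure Ω) (Z : V → Ω → ℝ) : Prop where
  aemeasurable : ∀ f, AEMeasurable (Z f) P
  linear : ∀ (α β : ℝ) (f g : V), Z (α • f + β • g) =ᵐ[P] fun ω => α * Z f ω + β * Z g ω
  continuous : ∀ f₀ : V, TendstoInMeasure P Z (𝓝 f₀) (Z f₀)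

/-- The norm `(‖f‖²_{L¹} + ‖f‖²_{L²})^{1/2}` on real-valued Schwartz functions. -/
def tripleNorm {d : ℕ} (f : 𝓢(EuclideanSpace ℝ (Fin d), ℝ)) : ℝ :=
  Real.sqrt ((∫ x, |f x|) ^ 2 + ∫ x, |f x| ^ 2)

/-- Continuity in probability with respect to `tripleNorm`: `Z f → Z f₀` in probability whenever
`tripleNorm (f - f₀) → 0`. -/
def IsTripleNormContinuous {d : ℕ} {Ω : Type*} [MeasurableSpace Ω] (P : Measure Ω)
    (Z : 𝓢(EuclideanSpace ℝ (Fin d), ℝ) → Ω → ℝ) : Prop :=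
  ∀ f₀, TendstoInMeasure P Z (comap (fun f => tripleNorm (f - f₀)) (𝓝 0)) (Z f₀)

/-- `Z` is a Lévy noise field associated with the characteristic triplet `T`: a generalized random
field indexed by the real-valued Schwartz functions, with `E exp (i Z(f)) = exp (∫ ψ(f(x)) dx)`. -/
structure IsLevyNoiseField {d : ℕ} {Ω : Type*} [MeasurableSpace Ω] (P : Measure Ω)
    (Z : 𝓢(EuclideanSpace ℝ (Fin d), ℝ) → Ω → ℝ) (T : LevyTriplet) : Prop where
  isGeneralizedRandomField : IsGeneralizedRandomField P Z
  integrable_psi : ∀ f : 𝓢(EuclideanSpace ℝ (Fin d), ℝ), Integrable (fun x => T.psi (f x))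
  charFunctional_eq : ∀ f : 𝓢(EuclideanSpace ℝ (Fin d), ℝ),
    ∫ ω, Complex.exp (Complex.I * Z f ω) ∂P = Complex.exp (∫ x, T.psi (f x))

end

/-! The logarithm of the characteristic functional is `∫ ψ(g(x)) dx`, and its directional
derivatives at `0` are the joint cumulants. Moments are derivatives of the exponential of this
functional, so the product rule organizes them by partitions.

Moments must exist before one may differentiate under the expectation. The moment conditions on `ν`
make `ψ` smooth (`hasDerivAt_psiDeriv`). Hence the characteristic function of each `Z f`, being `exp
∫ ψ(t f(x)) dx`, is smooth in `t`, and a second-difference argument gives all moments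
(`integrable_abs_pow_of_contDiff_charFun`).

For `M(s, g) = E[∏_{j ∈ s} (i Z(f_j)) exp(i Z(g))]` and the cumulant functional `κ`, repeated
differentiation of `M(∅, g) = exp κ(∅, g)` yields `M(s ∪ {a}, g) = ∑_{B ⊆ s} κ(B ∪ {a}, g) M(s \ B,
g)` (`expMoment_insert`). At `g = 0` the powers of `i` cancel, and
`eq_sum_finpartition_of_recursion` solves the recursion. -/

/-! ### Combinatorics: set partitions and the moment-cumulant recursion. -/

/-- Sum over partitions of `insert a s`, organized by the block that contains `a`. -/
theorem Finpartition.sum_prod_parts_insert {α R : Type*} [DecidableEq α] [CommSemiring R]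
    (K : Finset α → R) {a : α} {s : Finset α} (ha : a ∉ s) :
    ∑ I : Finpartition (insert a s), ∏ B ∈ I.parts, K B =
      ∑ B ∈ s.powerset, K (insert a B) * ∑ I : Finpartition (s \ B), ∏ C ∈ I.parts, K C := by
  have hmaps : ∀ I ∈ (univ : Finset (Finpartition (insert a s))),
      (I.part a).erase a ∈ s.powerset := by
    intro I _
    rw [mem_powerset, ← subset_insert_iff]
    exact I.part_subset a
  rw [← sum_fiberwise_of_maps_to hmaps]
  refine sum_congr rfl fun B hB => ?_
  rw [mem_powerset] at hB
  have haB : a ∉ B := fun h => ha (hB h)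
  have hne : insert a B ≠ (⊥ : Finset α) := (insert_nonempty a B).ne_empty
  have hdisj : Disjoint (s \ B) (insert a B) := by
    rw [disjoint_insert_right]
    exact ⟨fun h => ha (Finset.mem_sdiff.1 h).1, sdiff_disjoint⟩
  have hsup : (s \ B) ⊔ insert a B = insert a s := by
    ext x
    have := @hB x
    simp only [sup_eq_union, mem_union, Finset.mem_sdiff, mem_insert]
    tauto
  have hnot : ∀ J : Finpartition (s \ B), insert a B ∉ J.parts := fun J hJ =>
    ha (Finset.mem_sdiff.1 (J.le hJ (mem_insert_self a B))).1
  rw [mul_sum]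
  symm
  -- Adjoining the block `insert a B` to a partition of `s \ B` is inverted by erasing that block.
  refine sum_bij (fun J _ => J.extend hne hdisj hsup) ?_ ?_ ?_ ?_
  · intro J _
    rw [mem_filter]
    refine ⟨mem_univ _, ?_⟩
    have : (J.extend hne hdisj hsup).part a = insert a B :=
      Finpartition.part_eq_of_mem _ (mem_insert_self _ _) (mem_insert_self a B)
    rw [this, erase_insert haB]
  · intro J _ J' _ h
    have h' : insert (insert a B) J.parts = insert (insert a B) J'.parts :=
      congrArg Finpartition.parts h
    ext1
    rw [← erase_insert (hnot J), h', erase_insert (hnot J')]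
  · intro I hI
    have hIa : (I.part a).erase a = B := (mem_filter.1 hI).2
    have hmem : a ∈ insert a s := mem_insert_self a s
    have hpart : I.part a = insert a B := by
      rw [← hIa, insert_erase (I.mem_part_self.2 hmem)]
    have hin : insert a B ∈ I.parts := hpart ▸ I.part_mem.2 hmem
    have hs : (I.parts.erase (insert a B)).sup id = s \ B := by
      have h1 : insert a B ⊔ (I.parts.erase (insert a B)).sup id = insert a s := by
        have h := I.sup_parts
        rwa [← insert_erase hin, sup_insert, id] at h
      have h2 : Disjoint (insert a B) ((I.parts.erase (insert a B)).sup id) :=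
        I.supIndep (erase_subset _ _) hin (notMem_erase _ _)
      rw [← h2.sup_sdiff_cancel_left, h1, insert_sdiff_insert, sdiff_insert_of_notMem ha]
    refine ⟨Finpartition.copy (I.ofSubset (erase_subset (insert a B) I.parts) rfl) hs,
      mem_univ _, ?_⟩
    ext1
    exact insert_erase hin
  · intro J _
    exact (prod_insert (hnot J)).symm

/-- The moment-cumulant recursion is solved by the sum over all partitions. -/
theorem eq_sum_finpartition_of_recursion {α R : Type*} [DecidableEq α] [CommSemiring R]
    (K M : Finset α → R) (h0 : M ∅ = 1)
    (hM : ∀ (s : Finset α) (a : α), a ∉ s →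
      M (insert a s) = ∑ B ∈ s.powerset, K (insert a B) * M (s \ B)) (s : Finset α) :
    M s = ∑ I : Finpartition s, ∏ B ∈ I.parts, K B := by
  induction s using Finset.strongInduction with
  | H s ih =>
    rcases s.eq_empty_or_nonempty with rfl | ⟨a, ha⟩
    · rw [h0]
      have : ∀ I : Finpartition (∅ : Finset α), ∏ B ∈ I.parts, K B = 1 := fun I => by
        rw [I.parts_eq_empty_iff.2 rfl, prod_empty]
      have hcard : Fintype.card (Finpartition (∅ : Finset α)) = 1 :=
        Fintype.card_eq_one_iff.2 ⟨Finpartition.empty (Finset α), fun I => by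
          ext1
          rw [I.parts_eq_empty_iff.2 rfl]
          rfl⟩
      rw [sum_congr rfl fun I _ => this I, sum_const, card_univ, hcard, one_smul]
    · obtain ⟨t, hat, rfl⟩ : ∃ t, a ∉ t ∧ insert a t = s :=
        ⟨s.erase a, notMem_erase a s, insert_erase ha⟩
      rw [hM t a hat, Finpartition.sum_prod_parts_insert K hat]
      refine sum_congr rfl fun B _ => ?_
      rw [ih (t \ B) ((sdiff_subset).trans_ssubset (ssubset_insert hat))]

/-! ### Moments from smoothness of the characteristic function. -/

theorem memLp_of_integrable_abs_pow {α : Type*} [MeasurableSpace α] {μ : Measure α} {X : α → ℝ}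
    (hX : AEStronglyMeasurable X μ) {n : ℕ} (h : Integrable (fun a => |X a| ^ n) μ) :
    MemLp X n μ := by
  rcases Nat.eq_zero_or_pos n with rfl | hpos
  · simpa using hX
  · refine (integrable_norm_rpow_iff hX (by exact_mod_cast hpos.ne')
      (ENNReal.natCast_ne_top n)).1 ?_
    simpa using h

/-- A twice continuously differentiable function has second differences of order `t²`. -/
theorem ContDiff.exists_norm_second_difference_le {h : ℝ → ℂ} (hh : ContDiff ℝ 2 h) :
    ∃ C, ∀ t ∈ Set.Icc (0 : ℝ) 1, ‖h t + h (-t) - 2 * h 0‖ ≤ C * t ^ 2 := by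
  have hneg : ContDiff ℝ 2 fun t : ℝ => h (-t) := hh.comp contDiff_neg
  have hg : ContDiff ℝ 2 fun t => h t + h (-t) - 2 * h 0 :=
    (hh.add hneg).sub contDiff_const
  obtain ⟨C, hC⟩ := exists_taylor_mean_remainder_bound (n := 1) zero_le_one
    (show ContDiffOn ℝ ((1 : ℕ) + 1) (fun t => h t + h (-t) - 2 * h 0) (Set.Icc 0 1) by
      have : (((1 : ℕ) : WithTop ℕ∞) + 1) = 2 := by norm_num
      rw [this]; exact hg.contDiffOn)
  refine ⟨C, fun t ht => ?_⟩
  have hd : HasDerivAt (fun t => h t + h (-t) - 2 * h 0) 0 0 := by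
    have h1 : HasDerivAt h (deriv h 0) 0 :=
      ((hh.differentiable (by norm_num)) 0).hasDerivAt
    have h2 : HasDerivAt (fun t : ℝ => h (-t)) (-deriv h 0) 0 := by
      have h1' : HasDerivAt h (deriv h 0) (-0) := by simpa using h1
      simpa [Function.comp_def] using h1'.scomp (0 : ℝ) (hasDerivAt_neg (0 : ℝ))
    simpa using (h1.add h2).sub_const (2 * h 0)
  have hw : derivWithin (fun t => h t + h (-t) - 2 * h 0) (Set.Icc 0 1) 0 = 0 :=
    hd.hasDerivWithinAt.derivWithin (uniqueDiffOn_Icc zero_lt_one 0 (by simp))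
  have := hC t ht
  rw [taylorWithinEval_succ, taylor_within_zero_eval, iteratedDerivWithin_one, hw] at this
  simpa [two_mul] using this

/-- A finite even absolute moment propagates two orders up when the characteristic function is
smooth. -/
theorem memLp_add_two_of_contDiff_charFun {μ : Measure ℝ} [IsProbabilityMeasure μ]
    (hμ : ∀ n : ℕ, ContDiff ℝ n (charFun μ)) (n : ℕ) (hn : Integrable (fun x => x ^ (2 * n)) μ) :
    Integrable (fun x : ℝ => x ^ (2 * (n + 1))) μ := by
  have hmem : MemLp id ((2 * n : ℕ) : ENNReal) μ :=
    memLp_of_integrable_abs_pow aestronglyMeasurable_id (by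
      refine hn.congr (ae_of_all _ fun x => ?_)
      simp [pow_mul])
  set h : ℝ → ℂ := iteratedDeriv (2 * n) (charFun μ) with hdef
  have hh : ContDiff ℝ 2 h := by
    have := hμ (2 + 2 * n)
    rw [hdef, iteratedDeriv_eq_iterate]
    exact ContDiff.iterate_deriv' 2 (2 * n) this
  obtain ⟨C, hC⟩ := hh.exists_norm_second_difference_le
  have hint : ∀ t : ℝ, Integrable (fun x : ℝ => x ^ (2 * n) * (2 * (1 - Real.cos (t * x)))) μ := by
    intro t
    refine hn.mul_bdd (c := 4) (by fun_prop) (ae_of_all _ fun x => ?_)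
    have h1 := Real.cos_le_one (t * x)
    have h2 := Real.neg_one_le_cos (t * x)
    rw [Real.norm_eq_abs, abs_le]
    constructor <;> linarith
  have hintc : ∀ t : ℝ,
      Integrable (fun x : ℝ => (x : ℂ) ^ (2 * n) * Complex.exp (t * x * Complex.I)) μ := by
    intro t
    have hc : Integrable (fun x : ℝ => (x : ℂ) ^ (2 * n)) μ := by
      simpa using hn.ofReal (𝕜 := ℂ)
    refine hc.mul_bdd (c := 1) (by fun_prop) (ae_of_all _ fun x => ?_)
    rw [← Complex.ofReal_mul, Complex.norm_exp_ofReal_mul_I]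
  -- The second difference of `exp(itx)` at `t = 0` is `-2(1 - cos(tx))`, so up to a unimodular
  -- factor that of `h` is the integral of a nonnegative function.
  have key : ∀ t : ℝ, h t + h (-t) - 2 * h 0 =
      -(Complex.I ^ (2 * n) *
        ((∫ x, x ^ (2 * n) * (2 * (1 - Real.cos (t * x))) ∂μ : ℝ) : ℂ)) := by
    intro t
    simp only [hdef, iteratedDeriv_charFun hmem]
    have e : (fun x : ℝ => ((x ^ (2 * n) * (2 * (1 - Real.cos (t * x))) : ℝ) : ℂ)) = fun x : ℝ =>
        2 * ((x : ℂ) ^ (2 * n) * Complex.exp (((0 : ℝ) : ℂ) * x * Complex.I)) -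
        ((x : ℂ) ^ (2 * n) * Complex.exp (t * x * Complex.I) +
          (x : ℂ) ^ (2 * n) * Complex.exp (((-t : ℝ) : ℂ) * x * Complex.I)) := by
      funext x
      push_cast
      rw [Complex.cos]
      simp only [zero_mul, Complex.exp_zero]
      ring_nf
    have hadd : Integrable (fun x : ℝ => (x : ℂ) ^ (2 * n) * Complex.exp (t * x * Complex.I) +
        (x : ℂ) ^ (2 * n) * Complex.exp (((-t : ℝ) : ℂ) * x * Complex.I)) μ :=
      (hintc t).add (hintc (-t))
    rw [← integral_complex_ofReal, e, integral_sub ((hintc 0).const_mul 2) hadd, integral_add (hintc t) (hintc (-t)), integral_const_mul]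
    ring
  have hle : ∀ t ∈ Set.Icc (0 : ℝ) 1,
      ∫ x, x ^ (2 * n) * (2 * (1 - Real.cos (t * x))) ∂μ ≤ C * t ^ 2 := by
    intro t ht
    have := hC t ht
    rw [key, norm_neg, norm_mul, norm_pow, Complex.norm_I, one_pow, one_mul,
      Complex.norm_real] at this
    exact (le_abs_self _).trans this
  have hcover : AECover μ atTop fun R : ℝ => Set.Icc (-R) R :=
    aecover_Icc tendsto_neg_atTop_atBot tendsto_id
  -- The truncated moments over `[-R, R]` are bounded uniformly in `R`: the constant is `π² / (4t²)`
  -- times the second-difference bound `C t²`.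
  refine hcover.integrable_of_integral_bounded_of_nonneg_ae (C * Real.pi ^ 2 / 4)
    (fun R => ?_) (ae_of_all _ fun x => by
      rw [pow_mul]; positivity) ?_
  · exact (Continuous.continuousOn (by fun_prop)).integrableOn_compact isCompact_Icc
  · filter_upwards [eventually_ge_atTop Real.pi] with R hR
    have hpi := Real.pi_pos
    have hR0 : 0 < R := hpi.trans_le hR
    -- This choice gives `|t x| ≤ π` on `[-R, R]`, the range in which `1 - cos y ≥ 2 y² / π²`; `R ≥
    -- π` ensures `t ≤ 1`.
    set t := Real.pi / R with ht
    have ht0 : 0 < t := by positivity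
    have ht1 : t ≤ 1 := (div_le_one hR0).2 hR
    have h1 : ∫ x in Set.Icc (-R) R, x ^ (2 * (n + 1)) ∂μ ≤
        ∫ x in Set.Icc (-R) R,
          (Real.pi ^ 2 / (4 * t ^ 2)) * (x ^ (2 * n) * (2 * (1 - Real.cos (t * x)))) ∂μ := by
      refine setIntegral_mono_on ?_ ((hint t).const_mul _).integrableOn measurableSet_Icc ?_
      · exact (Continuous.continuousOn (by fun_prop)).integrableOn_compact isCompact_Icc
      · intro x hx
        have hx' : |t * x| ≤ Real.pi := by
          rw [abs_mul, abs_of_pos ht0]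
          calc t * |x| ≤ t * R := by gcongr; exact abs_le.2 hx
            _ = Real.pi := by rw [ht]; field_simp
        have hc := Real.cos_le_one_sub_mul_cos_sq hx'
        have hc' : 4 / Real.pi ^ 2 * (t * x) ^ 2 ≤ 2 * (1 - Real.cos (t * x)) := by
          have : 4 / Real.pi ^ 2 * (t * x) ^ 2 = 2 * (2 / Real.pi ^ 2 * (t * x) ^ 2) := by ring
          linarith
        calc x ^ (2 * (n + 1)) = (Real.pi ^ 2 / (4 * t ^ 2)) *
              (x ^ (2 * n) * (4 / Real.pi ^ 2 * (t * x) ^ 2)) := by field_simp; ring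
          _ ≤ _ := by
            have : 0 ≤ x ^ (2 * n) := by rw [pow_mul]; positivity
            gcongr
    have h2 : ∫ x in Set.Icc (-R) R,
          (Real.pi ^ 2 / (4 * t ^ 2)) * (x ^ (2 * n) * (2 * (1 - Real.cos (t * x)))) ∂μ ≤
        ∫ x, (Real.pi ^ 2 / (4 * t ^ 2)) * (x ^ (2 * n) * (2 * (1 - Real.cos (t * x)))) ∂μ := by
      refine setIntegral_le_integral ((hint t).const_mul _) (ae_of_all _ fun x => ?_)
      have : 0 ≤ x ^ (2 * n) := by rw [pow_mul]; positivity
      have := Real.cos_le_one (t * x)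
      have : 0 ≤ 1 - Real.cos (t * x) := by linarith
      simp only [Pi.zero_apply]
      positivity
    refine (h1.trans h2).trans ?_
    rw [integral_const_mul]
    calc Real.pi ^ 2 / (4 * t ^ 2) * ∫ x, x ^ (2 * n) * (2 * (1 - Real.cos (t * x))) ∂μ
        ≤ Real.pi ^ 2 / (4 * t ^ 2) * (C * t ^ 2) := by
          gcongr
          exact hle t ⟨ht0.le, ht1⟩
      _ = C * Real.pi ^ 2 / 4 := by field_simp

/-- A probability measure on the line with smooth characteristic function has all moments. -/
theorem integrable_abs_pow_of_contDiff_charFun {μ : Measure ℝ} [IsProbabilityMeasure μ]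
    (hμ : ∀ n : ℕ, ContDiff ℝ n (charFun μ)) (n : ℕ) : Integrable (fun x => |x| ^ n) μ := by
  have heven : ∀ n : ℕ, Integrable (fun x : ℝ => x ^ (2 * n)) μ := by
    intro n
    induction n with
    | zero => simp
    | succ k ih => exact memLp_add_two_of_contDiff_charFun hμ k ih
  refine ((integrable_const (1 : ℝ)).add (heven n)).mono' (by fun_prop) (ae_of_all _ fun x => ?_)
  rw [Real.norm_of_nonneg (by positivity)]
  have h2 : x ^ (2 * n) = (|x| ^ n) ^ 2 := by rw [← pow_mul, mul_comm n 2, pow_mul, pow_mul, sq_abs]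
  simp only [Pi.add_apply]
  nlinarith [sq_nonneg (|x| ^ n - 1), h2, pow_nonneg (abs_nonneg x) n]

/-! ### Smoothness of the Lévy characteristic. -/

theorem Complex.norm_exp_I_mul_ofReal_sub_one_sub_le (x : ℝ) :
    ‖Complex.exp (Complex.I * x) - 1 - Complex.I * x‖ ≤ 2 * x ^ 2 := by
  have hn : ‖Complex.I * (x : ℂ)‖ = |x| := by simp
  rcases le_total |x| 1 with h | h
  · refine (Complex.norm_exp_sub_one_sub_id_le (hn.le.trans h)).trans ?_
    rw [hn, sq_abs]
    nlinarith [sq_nonneg x]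
  · refine (norm_sub_le _ _).trans ?_
    have h1 := Real.norm_exp_I_mul_ofReal_sub_one_le (x := x)
    rw [Real.norm_eq_abs] at h1
    rw [hn, ← sq_abs x]
    nlinarith

namespace LevyTriplet

variable (T : LevyTriplet)

/-- The successive derivatives of the Lévy characteristic, in the form without truncation. -/
noncomputable def psiDeriv : ℕ → ℝ → ℂ
  | 0, t => Complex.I * T.c 1 * t - T.sigmaSq * t ^ 2 / 2 +
      ∫ s : ℝ, (Complex.exp (Complex.I * t * s) - 1 - Complex.I * t * s) ∂T.ν
  | 1, t => Complex.I * T.c 1 - T.sigmaSq * t +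
      ∫ s : ℝ, Complex.I * s * (Complex.exp (Complex.I * t * s) - 1) ∂T.ν
  | 2, t => -T.sigmaSq + ∫ s : ℝ, (Complex.I * s) ^ 2 * Complex.exp (Complex.I * t * s) ∂T.ν
  | k + 3, t => ∫ s : ℝ, (Complex.I * s) ^ (k + 3) * Complex.exp (Complex.I * t * s) ∂T.ν

theorem norm_exp_I_mul_mul (t s : ℝ) : ‖Complex.exp (Complex.I * t * s)‖ = 1 := by
  rw [mul_assoc, ← Complex.ofReal_mul, Complex.norm_exp_I_mul_ofReal]

theorem hasDerivAt_exp_I_mul_mul (t s : ℝ) :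
    HasDerivAt (fun t : ℝ => Complex.exp (Complex.I * t * s))
      (Complex.I * s * Complex.exp (Complex.I * t * s)) t := by
  have h1 : HasDerivAt (fun t : ℝ => Complex.I * (t : ℂ) * s) (Complex.I * s) t := by
    simpa using ((Complex.ofRealCLM.hasDerivAt (x := t)).const_mul Complex.I).mul_const (s : ℂ)
  simpa [mul_comm] using h1.cexp

variable {T}

theorem integrable_compensated (hb : ∀ n : ℕ, 2 ≤ n → Integrable (fun s : ℝ => s ^ n) T.ν)
    (t : ℝ) :
    Integrable (fun s : ℝ => Complex.exp (Complex.I * t * s) - 1 - Complex.I * t * s) T.ν := by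
  refine ((hb 2 le_rfl).const_mul (2 * t ^ 2)).mono' (by fun_prop) (ae_of_all _ fun s => ?_)
  have := Complex.norm_exp_I_mul_ofReal_sub_one_sub_le (t * s)
  rw [Complex.ofReal_mul, ← mul_assoc, mul_pow, ← mul_assoc] at this
  exact this

theorem integrable_pow_mul_exp (hb : ∀ n : ℕ, 2 ≤ n → Integrable (fun s : ℝ => s ^ n) T.ν)
    {k : ℕ} (hk : 2 ≤ k) (t : ℝ) :
    Integrable (fun s : ℝ => (Complex.I * s) ^ k * Complex.exp (Complex.I * t * s)) T.ν := by
  refine (hb k hk).norm.mono' (by fun_prop) (ae_of_all _ fun s => ?_)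
  rw [norm_mul, norm_exp_I_mul_mul]
  simp

theorem norm_I_mul_mul_exp_sub_one_le (t s : ℝ) :
    ‖Complex.I * s * (Complex.exp (Complex.I * t * s) - 1)‖ ≤ |t| * s ^ 2 := by
  have h1 := Real.norm_exp_I_mul_ofReal_sub_one_le (x := t * s)
  rw [Complex.ofReal_mul, ← mul_assoc, Real.norm_eq_abs, abs_mul] at h1
  rw [norm_mul, norm_mul, Complex.norm_I, one_mul, Complex.norm_real, Real.norm_eq_abs, ← sq_abs s]
  calc |s| * _ ≤ |s| * (|t| * |s|) := by gcongr
    _ = |t| * |s| ^ 2 := by ring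

theorem integrable_I_mul_mul_exp_sub_one
    (hb : ∀ n : ℕ, 2 ≤ n → Integrable (fun s : ℝ => s ^ n) T.ν) (t : ℝ) :
    Integrable (fun s : ℝ => Complex.I * s * (Complex.exp (Complex.I * t * s) - 1)) T.ν :=
  ((hb 2 le_rfl).const_mul |t|).mono' (by fun_prop)
    (ae_of_all _ fun s => norm_I_mul_mul_exp_sub_one_le t s)

/-- Replacing the truncated compensator by the full one changes the integrand by `i t s 1_{|s| >
1}`, which integrates to `i t b₁` and turns the drift `b` into `c₁`. -/
theorem psi_eq_psiDeriv_zero (hb₁ : IntegrableOn (fun s : ℝ => s) {s : ℝ | 1 < |s|} T.ν)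
    (hb : ∀ n : ℕ, 2 ≤ n → Integrable (fun s : ℝ => s ^ n) T.ν) (t : ℝ) :
    T.psi t = T.psiDeriv 0 t := by
  have hmeas : MeasurableSet {s : ℝ | 1 < |s|} := measurableSet_lt (by fun_prop) (by fun_prop)
  have hi : Integrable ({s : ℝ | 1 < |s|}.indicator fun s => s) T.ν :=
    (integrable_indicator_iff hmeas).2 hb₁
  have e : (fun s : ℝ => Complex.exp (Complex.I * t * s) - 1 -
      Complex.I * t * ({r : ℝ | |r| ≤ 1}.indicator (fun r => r) s : ℝ)) = fun s : ℝ =>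
      (Complex.exp (Complex.I * t * s) - 1 - Complex.I * t * s) +
        Complex.I * t * (({s : ℝ | 1 < |s|}.indicator (fun s => s) s : ℝ) : ℂ) := by
    funext s
    by_cases hs : |s| ≤ 1
    · simp [Set.indicator, hs, not_lt.2 hs]
    · simp [Set.indicator, hs, not_le.1 hs]
  have hi' : Integrable (fun s : ℝ => Complex.I * t *
      (({s : ℝ | 1 < |s|}.indicator (fun s => s) s : ℝ) : ℂ)) T.ν := hi.ofReal.const_mul _
  rw [psi, psiDeriv, e, integral_add (integrable_compensated hb t) hi', integral_const_mul,
    integral_complex_ofReal, integral_indicator hmeas]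
  simp only [c, levyMoment, if_true]
  push_cast
  ring

/-- Near the origin only powers `s^n` with `n ≥ 2` are known to be `ν`-integrable, so orders 0 and 1
keep their compensators and are treated separately. The differentiated integrands are dominated by
`(|t| + 1) s²` at order 0, `s²` at order 1 and `|s|^(k+1)` from order `k = 2` on. -/
theorem hasDerivAt_psiDeriv (hb : ∀ n : ℕ, 2 ≤ n → Integrable (fun s : ℝ => s ^ n) T.ν)
    (k : ℕ) (t : ℝ) : HasDerivAt (T.psiDeriv k) (T.psiDeriv (k + 1) t) t := by
  have hid : HasDerivAt (fun t : ℝ => (t : ℂ)) 1 t := Complex.ofRealCLM.hasDerivAt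
  have hpow : ∀ k : ℕ, 2 ≤ k → HasDerivAt
      (fun t : ℝ => ∫ s : ℝ, (Complex.I * s) ^ k * Complex.exp (Complex.I * t * s) ∂T.ν)
      (∫ s : ℝ, (Complex.I * s) ^ (k + 1) * Complex.exp (Complex.I * t * s) ∂T.ν) t := by
    intro k hk
    refine (hasDerivAt_integral_of_dominated_loc_of_deriv_le (s := Set.univ)
      (F' := fun t s => (Complex.I * s) ^ (k + 1) * Complex.exp (Complex.I * t * s))
      (bound := fun s => ‖s ^ (k + 1)‖) univ_mem
      (Eventually.of_forall fun t => (integrable_pow_mul_exp hb hk t).aestronglyMeasurable)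
      (integrable_pow_mul_exp hb hk t)
      (integrable_pow_mul_exp hb (hk.trans k.le_succ) t).aestronglyMeasurable
      (ae_of_all _ fun s x _ => ?_) (hb (k + 1) (hk.trans k.le_succ)).norm
      (ae_of_all _ fun s x _ => ?_)).2
    · rw [norm_mul, norm_exp_I_mul_mul]
      simp
    · have := (hasDerivAt_exp_I_mul_mul x s).const_mul ((Complex.I * s) ^ k)
      rwa [← mul_assoc, ← pow_succ] at this
  match k with
  | 0 =>
    refine HasDerivAt.add ?_ ?_
    · have h := (hid.const_mul (Complex.I * T.c 1)).sub
        (((hid.pow 2).const_mul (T.sigmaSq : ℂ)).div_const 2)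
      refine h.congr_deriv ?_
      norm_num
      ring
    · refine (hasDerivAt_integral_of_dominated_loc_of_deriv_le (s := Metric.ball t 1)
        (F' := fun t s => Complex.I * s * (Complex.exp (Complex.I * t * s) - 1))
        (bound := fun s => (|t| + 1) * s ^ 2) (Metric.ball_mem_nhds t one_pos)
        (Eventually.of_forall fun t => (integrable_compensated hb t).aestronglyMeasurable)
        (integrable_compensated hb t)
        (integrable_I_mul_mul_exp_sub_one hb t).aestronglyMeasurable
        (ae_of_all _ fun s x hx => ?_) ((hb 2 le_rfl).const_mul _)
        (ae_of_all _ fun s x _ => ?_)).2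
      · refine (norm_I_mul_mul_exp_sub_one_le x s).trans ?_
        rw [Metric.mem_ball, Real.dist_eq] at hx
        have : |x| ≤ |t| + 1 := by
          have := abs_sub_abs_le_abs_sub x t
          linarith
        gcongr
      · have hid : HasDerivAt (fun t : ℝ => (t : ℂ)) 1 x := Complex.ofRealCLM.hasDerivAt
        have h := ((hasDerivAt_exp_I_mul_mul x s).sub_const 1).sub
          ((hid.const_mul Complex.I).mul_const (s : ℂ))
        refine h.congr_deriv ?_
        ring
  | 1 =>
    refine HasDerivAt.add ?_ ?_
    · have h := (hid.const_mul (T.sigmaSq : ℂ)).const_sub (Complex.I * T.c 1)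
      simpa using h
    · refine (hasDerivAt_integral_of_dominated_loc_of_deriv_le (s := Set.univ)
        (F' := fun t s => (Complex.I * s) ^ 2 * Complex.exp (Complex.I * t * s))
        (bound := fun s => ‖s ^ 2‖) univ_mem
        (Eventually.of_forall fun t =>
          (integrable_I_mul_mul_exp_sub_one hb t).aestronglyMeasurable)
        (integrable_I_mul_mul_exp_sub_one hb t)
        (integrable_pow_mul_exp hb le_rfl t).aestronglyMeasurable
        (ae_of_all _ fun s x _ => ?_) (hb 2 le_rfl).norm
        (ae_of_all _ fun s x _ => ?_)).2
      · rw [norm_mul, norm_exp_I_mul_mul]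
        simp
      · have h := ((hasDerivAt_exp_I_mul_mul x s).sub_const 1).const_mul (Complex.I * (s : ℂ))
        refine h.congr_deriv ?_
        ring
  | 2 => exact (hpow 2 le_rfl).const_add _
  | k + 3 => exact hpow (k + 3) (by omega)

theorem continuous_psiDeriv (hb : ∀ n : ℕ, 2 ≤ n → Integrable (fun s : ℝ => s ^ n) T.ν)
    (k : ℕ) : Continuous (T.psiDeriv k) :=
  continuous_iff_continuousAt.2 fun t => (hasDerivAt_psiDeriv hb k t).continuousAt

theorem psiDeriv_apply_zero {k : ℕ} (hk : k ≠ 0) :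
    T.psiDeriv k 0 = Complex.I ^ k * T.c k := by
  have hpow : ∀ k : ℕ, ∫ s : ℝ, (Complex.I * s) ^ k * Complex.exp (Complex.I * (0 : ℝ) * s) ∂T.ν =
      Complex.I ^ k * ((∫ s : ℝ, s ^ k ∂T.ν : ℝ) : ℂ) := by
    intro k
    rw [← integral_complex_ofReal, ← integral_const_mul]
    simp [mul_pow]
  match k, hk with
  | 1, _ => simp [psiDeriv]
  | 2, _ =>
    rw [psiDeriv, hpow]
    simp [c, levyMoment]
    ring
  | k + 3, _ =>
    rw [psiDeriv, hpow]
    simp [c, levyMoment]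

end LevyTriplet

/-! ### Differentiation under the spatial integral. -/

namespace SchwartzMap

variable {d : ℕ}

theorem exists_abs_le (f : 𝓢(EuclideanSpace ℝ (Fin d), ℝ)) : ∃ C, 0 ≤ C ∧ ∀ x, |f x| ≤ C :=
  ⟨SchwartzMap.seminorm ℝ 0 0 f, apply_nonneg _ _, fun x => norm_le_seminorm ℝ f x⟩

theorem integrable_mul_prod {ι : Type*} (f : ι → 𝓢(EuclideanSpace ℝ (Fin d), ℝ)) (a : ι)
    (B : Finset ι) : Integrable fun x => f a x * ∏ j ∈ B, f j x := by
  classical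
  induction B using Finset.induction_on with
  | empty => simpa using (f a).integrable
  | insert b B hb ih =>
    obtain ⟨C, -, hC⟩ := (f b).exists_abs_le
    refine (ih.mul_bdd (c := C) (f b).continuous.aestronglyMeasurable
      (ae_of_all _ hC)).congr (ae_of_all _ fun x => ?_)
    simp only [prod_insert hb]
    ring

theorem integrable_comp_mul {φ : ℝ → ℂ} (hφ : Continuous φ)
    (g : 𝓢(EuclideanSpace ℝ (Fin d), ℝ)) {w : EuclideanSpace ℝ (Fin d) → ℝ}
    (hw : Integrable w) : Integrable fun x => φ (g x) * (w x : ℂ) := by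
  obtain ⟨R, -, hR⟩ := g.exists_abs_le
  obtain ⟨M, hM⟩ := (isCompact_Icc (a := -R) (b := R)).exists_bound_of_continuousOn hφ.continuousOn
  exact hw.ofReal.bdd_mul (c := M) (hφ.comp g.continuous).aestronglyMeasurable
    (ae_of_all _ fun x => hM _ (abs_le.1 (hR x)))

/-- Differentiation under the integral sign along a line of Schwartz functions. -/
theorem hasDerivAt_integral_comp_mul {φ φ' : ℝ → ℂ} (hφ : ∀ t, HasDerivAt φ (φ' t) t)
    (hφ' : Continuous φ') (g f : 𝓢(EuclideanSpace ℝ (Fin d), ℝ))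
    {w : EuclideanSpace ℝ (Fin d) → ℝ} (hw : Continuous w)
    (hfw : Integrable fun x => f x * w x) (t₀ : ℝ)
    (hint : Integrable fun x => φ ((g + t₀ • f) x) * (w x : ℂ)) :
    HasDerivAt (fun t : ℝ => ∫ x, φ ((g + t • f) x) * (w x : ℂ))
      (∫ x, φ' ((g + t₀ • f) x) * ((f x * w x : ℝ) : ℂ)) t₀ := by
  obtain ⟨R, hR0, hR⟩ := g.exists_abs_le
  obtain ⟨S, hS0, hS⟩ := f.exists_abs_le
  -- For `|t - t₀| < 1` all values of `g + t f` lie in `[-r, r]`, where the continuous `φ'` is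
  -- bounded.
  set r := R + (|t₀| + 1) * S with hr
  obtain ⟨M, hM⟩ :=
    (isCompact_Icc (a := -r) (b := r)).exists_bound_of_continuousOn hφ'.continuousOn
  have hcφ : Continuous φ := continuous_iff_continuousAt.2 fun t => (hφ t).continuousAt
  refine (hasDerivAt_integral_of_dominated_loc_of_deriv_le (s := Metric.ball t₀ 1)
    (F' := fun t x => φ' ((g + t • f) x) * ((f x * w x : ℝ) : ℂ))
    (bound := fun x => M * ‖f x * w x‖) (Metric.ball_mem_nhds t₀ one_pos)
    (Eventually.of_forall fun t => ?_) hint ?_ (ae_of_all _ fun x t ht => ?_)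
    (hfw.norm.const_mul M) (ae_of_all _ fun x t _ => ?_)).2
  · exact ((hcφ.comp (g + t • f).continuous).mul
      (Complex.continuous_ofReal.comp hw)).aestronglyMeasurable
  · exact ((hφ'.comp (g + t₀ • f).continuous).mul
      (Complex.continuous_ofReal.comp (f.continuous.mul hw))).aestronglyMeasurable
  · rw [norm_mul, Complex.norm_real]
    refine mul_le_mul_of_nonneg_right (hM _ (abs_le.1 ?_)) (norm_nonneg _)
    rw [Metric.mem_ball, Real.dist_eq] at ht
    have ht' : |t| ≤ |t₀| + 1 := by
      have := abs_sub_abs_le_abs_sub t t₀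
      linarith
    calc |(g + t • f) x| = |g x + t * f x| := by simp
      _ ≤ |g x| + |t| * |f x| := by rw [← abs_mul]; exact abs_add_le _ _
      _ ≤ r := by rw [hr]; gcongr; exacts [hR x, hS x]
  · have h1 : HasDerivAt (fun t : ℝ => (g + t • f) x) (f x) t := by
      simpa using ((hasDerivAt_id t).mul_const (f x)).const_add (g x)
    have h2 := (HasDerivAt.scomp t (hφ ((g + t • f) x)) h1).mul_const (w x : ℂ)
    refine h2.congr_deriv ?_
    rw [Complex.real_smul]
    push_cast
    ring

end SchwartzMap

/-! ### The cumulant functional and its directional derivatives. -/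

namespace LevyTriplet

variable {d : ℕ} {ι : Type*} {T : LevyTriplet}

/-- The joint cumulant functional `∫ ψ^(|B|)(g(x)) ∏_{j ∈ B} f_j(x) dx`. -/
noncomputable def cumulant (T : LevyTriplet) (f : ι → 𝓢(EuclideanSpace ℝ (Fin d), ℝ))
    (B : Finset ι) (g : 𝓢(EuclideanSpace ℝ (Fin d), ℝ)) : ℂ :=
  ∫ x, T.psiDeriv #B (g x) * ((∏ j ∈ B, f j x : ℝ) : ℂ)

theorem cumulant_zero (f : ι → 𝓢(EuclideanSpace ℝ (Fin d), ℝ)) {B : Finset ι}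
    (hB : B.Nonempty) :
    T.cumulant f B 0 = Complex.I ^ #B * ((T.c #B * ∫ x, ∏ j ∈ B, f j x : ℝ) : ℂ) := by
  simp only [cumulant, _root_.zero_apply, psiDeriv_apply_zero hB.card_ne_zero]
  rw [integral_const_mul, integral_complex_ofReal]
  push_cast
  ring

theorem hasDerivAt_cumulant [DecidableEq ι]
    (hb : ∀ n : ℕ, 2 ≤ n → Integrable (fun s : ℝ => s ^ n) T.ν)
    (hψ : ∀ g : 𝓢(EuclideanSpace ℝ (Fin d), ℝ), Integrable fun x => T.psiDeriv 0 (g x))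
    (f : ι → 𝓢(EuclideanSpace ℝ (Fin d), ℝ)) {B : Finset ι} {a : ι} (ha : a ∉ B)
    (g : 𝓢(EuclideanSpace ℝ (Fin d), ℝ)) (t₀ : ℝ) :
    HasDerivAt (fun t : ℝ => T.cumulant f B (g + t • f a))
      (T.cumulant f (insert a B) (g + t₀ • f a)) t₀ := by
  simp only [cumulant, card_insert_of_notMem ha, prod_insert ha]
  refine SchwartzMap.hasDerivAt_integral_comp_mul (hasDerivAt_psiDeriv hb #B)
    (continuous_psiDeriv hb _) g (f a) (by fun_prop)
    (SchwartzMap.integrable_mul_prod f a B) t₀ ?_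
  -- For empty `B` the weight is the constant `1`, which gives no decay; integrability then rests on
  -- that of `ψ ∘ g`. Otherwise the weight is itself integrable.
  rcases B.eq_empty_or_nonempty with rfl | ⟨b, hbB⟩
  · simpa using hψ (g + t₀ • f a)
  · refine SchwartzMap.integrable_comp_mul (continuous_psiDeriv hb _) _ ?_
    exact (SchwartzMap.integrable_mul_prod f b (B.erase b)).congr
      (ae_of_all _ fun x => mul_prod_erase B (fun j => f j x) hbB)

/-- Each `t`-derivative contributes one more factor `f`. The constant family indexed by `range k`
only counts these factors, so the cumulants of successive sizes form a chain of derivatives. -/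
theorem contDiff_cumulant_line
    (hb : ∀ n : ℕ, 2 ≤ n → Integrable (fun s : ℝ => s ^ n) T.ν)
    (hψ : ∀ g : 𝓢(EuclideanSpace ℝ (Fin d), ℝ), Integrable fun x => T.psiDeriv 0 (g x))
    (f : 𝓢(EuclideanSpace ℝ (Fin d), ℝ)) (n : ℕ) :
    ContDiff ℝ n fun t : ℝ => ∫ x, T.psiDeriv 0 ((t • f) x) := by
  have hd : ∀ (k : ℕ) (t : ℝ), HasDerivAt
      (fun t : ℝ => T.cumulant (fun _ : ℕ => f) (range k) (0 + t • f))
      (T.cumulant (fun _ : ℕ => f) (range (k + 1)) (0 + t • f)) t := by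
    intro k t
    rw [range_add_one]
    exact hasDerivAt_cumulant hb hψ (fun _ : ℕ => f) (notMem_range_self (n := k)) 0 t
  have hk : ∀ (n k : ℕ), ContDiff ℝ n
      fun t : ℝ => T.cumulant (fun _ : ℕ => f) (range k) (0 + t • f) := by
    intro n
    induction n with
    | zero =>
      intro k
      exact contDiff_zero.2 (continuous_iff_continuousAt.2 fun t => (hd k t).continuousAt)
    | succ n ih =>
      intro k
      rw [Nat.cast_add, Nat.cast_one, contDiff_succ_iff_deriv]
      refine ⟨fun t => (hd k t).differentiableAt, by simp, ?_⟩
      rw [funext fun t => (hd k t).deriv]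
      exact ih (k + 1)
  simpa [cumulant] using hk n 0

end LevyTriplet

/-! ### Exponential moments of a random field. -/

namespace IsGeneralizedRandomField

variable {V Ω : Type*} [AddCommGroup V] [Module ℝ V] [TopologicalSpace V] [MeasurableSpace Ω]
  {P : Measure Ω} {Z : V → Ω → ℝ}

theorem add_smul_ae (hZ : IsGeneralizedRandomField P Z) (g f : V) (t : ℝ) :
    Z (g + t • f) =ᵐ[P] fun ω => Z g ω + t * Z f ω := by
  simpa using hZ.linear 1 t g f

theorem smul_ae (hZ : IsGeneralizedRandomField P Z) (f : V) (t : ℝ) :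
    Z (t • f) =ᵐ[P] fun ω => t * Z f ω := by
  simpa using hZ.linear t 0 f 0

theorem zero_ae (hZ : IsGeneralizedRandomField P Z) : Z 0 =ᵐ[P] fun _ => 0 := by
  simpa using hZ.smul_ae 0 0

/-- Hölder's inequality with all `#s` exponents equal to `#s`. -/
theorem integrable_prod_abs [IsProbabilityMeasure P] (hZ : IsGeneralizedRandomField P Z)
    (hmom : ∀ (f : V) (n : ℕ), Integrable (fun ω => |Z f ω| ^ n) P) {ι : Type*} (f : ι → V)
    (s : Finset ι) : Integrable (fun ω => ∏ j ∈ s, |Z (f j) ω|) P := by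
  rcases s.eq_empty_or_nonempty with rfl | hs
  · simp
  have hp : ∀ j ∈ s, MemLp (fun ω => |Z (f j) ω|) ((#s : ℕ) : ENNReal) P := fun j _ =>
    (memLp_of_integrable_abs_pow (hZ.aemeasurable (f j)).aestronglyMeasurable
      (hmom (f j) #s)).norm
  have h := MemLp.prod' hp
  have e : (∑ _ ∈ s, (((#s : ℕ) : ENNReal))⁻¹)⁻¹ = 1 := by
    rw [sum_const, nsmul_eq_mul, ENNReal.mul_inv_cancel (by exact_mod_cast hs.card_ne_zero)
      (ENNReal.natCast_ne_top _), inv_one]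
  rw [e] at h
  exact memLp_one_iff_integrable.1 h

/-- The functional `E[∏_{j ∈ s} (i Z(f_j)) exp(i Z(g))]`. -/
noncomputable def expMoment (P : Measure Ω) (Z : V → Ω → ℝ) {ι : Type*} (f : ι → V)
    (s : Finset ι) (g : V) : ℂ :=
  ∫ ω, (∏ j ∈ s, Complex.I * Z (f j) ω) * Complex.exp (Complex.I * Z g ω) ∂P

theorem expMoment_zero (hZ : IsGeneralizedRandomField P Z) {ι : Type*} (f : ι → V)
    (s : Finset ι) :
    expMoment P Z f s 0 = Complex.I ^ #s * ((∫ ω, ∏ j ∈ s, Z (f j) ω ∂P : ℝ) : ℂ) := by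
  rw [← integral_complex_ofReal, ← integral_const_mul]
  refine integral_congr_ae ?_
  filter_upwards [hZ.zero_ae] with ω hω
  simp [hω, prod_mul_distrib]

/-- The exponential has modulus one, so `∏ |Z(f_j)|` over `insert a s` dominates the derivative. The
base point `g` is arbitrary, so the derivative at `t = 0` suffices. -/
theorem hasDerivAt_expMoment [IsProbabilityMeasure P] (hZ : IsGeneralizedRandomField P Z)
    (hmom : ∀ (f : V) (n : ℕ), Integrable (fun ω => |Z f ω| ^ n) P) {ι : Type*} [DecidableEq ι]
    (f : ι → V) {s : Finset ι} {a : ι} (ha : a ∉ s) (g : V) :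
    HasDerivAt (fun t : ℝ => expMoment P Z f s (g + t • f a)) (expMoment P Z f (insert a s) g)
      0 := by
  have hmeas : ∀ f : V, AEMeasurable (fun ω => (Z f ω : ℂ)) P := fun f =>
    Complex.measurable_ofReal.comp_aemeasurable (hZ.aemeasurable f)
  have hprod : ∀ s : Finset ι, AEMeasurable (fun ω => ∏ j ∈ s, Complex.I * (Z (f j) ω : ℂ)) P :=
    fun s => Finset.aemeasurable_fun_prod s fun j _ => (hmeas (f j)).const_mul _
  have hnorm : ∀ (x y : ℝ) (t : ℝ), ‖Complex.exp (Complex.I * (x + t * y))‖ = 1 := fun x y t => by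
    rw [← Complex.ofReal_mul, ← Complex.ofReal_add, Complex.norm_exp_I_mul_ofReal]
  have hexp : ∀ t : ℝ, AEMeasurable (fun ω => Complex.exp (Complex.I * (Z g ω + t * Z (f a) ω))) P :=
    fun t => Complex.measurable_exp.comp_aemeasurable
      (((hmeas g).add ((hmeas (f a)).const_mul _)).const_mul _)
  have hpn : ∀ (s : Finset ι) (ω : Ω),
      ‖∏ j ∈ s, Complex.I * (Z (f j) ω : ℂ)‖ = ∏ j ∈ s, |Z (f j) ω| := fun s ω => by
    simp [norm_prod]
  -- The null set in almost sure linearity depends on `t`. The integrand is therefore replaced, for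
  -- each `t`, by a version that is differentiable for every `ω`.
  have e : ∀ t : ℝ, expMoment P Z f s (g + t • f a) =
      ∫ ω, (∏ j ∈ s, Complex.I * Z (f j) ω) *
        Complex.exp (Complex.I * (Z g ω + t * Z (f a) ω)) ∂P := fun t => by
    refine integral_congr_ae ?_
    filter_upwards [hZ.add_smul_ae g (f a) t] with ω hω
    rw [hω]
    push_cast
    rfl
  have e0 : expMoment P Z f (insert a s) g =
      ∫ ω, (∏ j ∈ insert a s, Complex.I * Z (f j) ω) *
        Complex.exp (Complex.I * (Z g ω + (0 : ℝ) * Z (f a) ω)) ∂P := by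
    simp [expMoment]
  rw [funext e, e0]
  refine (hasDerivAt_integral_of_dominated_loc_of_deriv_le (s := Set.univ)
    (F' := fun (t : ℝ) ω => (∏ j ∈ insert a s, Complex.I * (Z (f j) ω : ℂ)) *
      Complex.exp (Complex.I * (Z g ω + t * Z (f a) ω)))
    (bound := fun ω => ∏ j ∈ insert a s, |Z (f j) ω|) univ_mem
    (Eventually.of_forall fun t => ((hprod s).mul (hexp t)).aestronglyMeasurable)
    ((hZ.integrable_prod_abs hmom f s).mono' ((hprod s).mul (hexp 0)).aestronglyMeasurable
      (ae_of_all _ fun ω => ?_))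
    ((hprod _).mul (hexp 0)).aestronglyMeasurable
    (ae_of_all _ fun ω t _ => ?_) (hZ.integrable_prod_abs hmom f _)
    (ae_of_all _ fun ω t _ => ?_)).2
  · rw [Pi.mul_apply, norm_mul, hnorm, mul_one, hpn]
  · rw [norm_mul, hnorm, mul_one, hpn]
  · have h1 : HasDerivAt (fun t : ℝ => Complex.I * ((Z g ω : ℂ) + t * Z (f a) ω))
        (Complex.I * Z (f a) ω) t := by
      simpa using (((Complex.ofRealCLM.hasDerivAt (x := t)).mul_const
        (Z (f a) ω : ℂ)).const_add (Z g ω : ℂ)).const_mul Complex.I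
    refine (h1.cexp.const_mul (∏ j ∈ s, Complex.I * (Z (f j) ω : ℂ))).congr_deriv ?_
    rw [prod_insert ha]
    ring

end IsGeneralizedRandomField

/-! ### Lévy noise: existence of moments and the recursion. -/

namespace IsLevyNoiseField

open IsGeneralizedRandomField

variable {d : ℕ} {Ω : Type*} [MeasurableSpace Ω] {P : Measure Ω}
  {T : LevyTriplet} {Z : 𝓢(EuclideanSpace ℝ (Fin d), ℝ) → Ω → ℝ}

theorem integrable_psiDeriv_zero (hZ : IsLevyNoiseField P Z T)
    (hb₁ : IntegrableOn (fun s : ℝ => s) {s : ℝ | 1 < |s|} T.ν)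
    (hb : ∀ n : ℕ, 2 ≤ n → Integrable (fun s : ℝ => s ^ n) T.ν)
    (g : 𝓢(EuclideanSpace ℝ (Fin d), ℝ)) : Integrable fun x => T.psiDeriv 0 (g x) := by
  simpa only [LevyTriplet.psi_eq_psiDeriv_zero hb₁ hb] using hZ.integrable_psi g

variable [IsProbabilityMeasure P]

theorem integrable_abs_pow (hZ : IsLevyNoiseField P Z T)
    (hb₁ : IntegrableOn (fun s : ℝ => s) {s : ℝ | 1 < |s|} T.ν)
    (hb : ∀ n : ℕ, 2 ≤ n → Integrable (fun s : ℝ => s ^ n) T.ν)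
    (f : 𝓢(EuclideanSpace ℝ (Fin d), ℝ)) (n : ℕ) : Integrable (fun ω => |Z f ω| ^ n) P := by
  have hG := hZ.isGeneralizedRandomField
  have hm := hG.aemeasurable f
  have : IsProbabilityMeasure (P.map (Z f)) := Measure.isProbabilityMeasure_map hm
  have hchar : charFun (P.map (Z f)) =
      fun t : ℝ => Complex.exp (∫ x, T.psiDeriv 0 ((t • f) x)) := by
    funext t
    rw [charFun_apply_real, integral_map hm (by fun_prop)]
    simp only [← LevyTriplet.psi_eq_psiDeriv_zero hb₁ hb]
    rw [← hZ.charFunctional_eq (t • f)]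
    refine integral_congr_ae ?_
    filter_upwards [hG.smul_ae f t] with ω hω
    rw [hω]
    push_cast
    ring_nf
  have hsmooth : ∀ n : ℕ, ContDiff ℝ n (charFun (P.map (Z f))) := fun n => by
    rw [hchar]
    exact (LevyTriplet.contDiff_cumulant_line hb (hZ.integrable_psiDeriv_zero hb₁ hb) f n).cexp
  exact (integrable_map_measure (by fun_prop) hm).1
    (integrable_abs_pow_of_contDiff_charFun hsmooth n)

/-- Differentiating the identity for `s` in direction `f b` sends the new index `b` either into the
block of `a` or into the remaining moment. These are the two halves of the subsets of `insert b s`.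
-/
theorem expMoment_insert (hZ : IsLevyNoiseField P Z T)
    (hb₁ : IntegrableOn (fun s : ℝ => s) {s : ℝ | 1 < |s|} T.ν)
    (hb : ∀ n : ℕ, 2 ≤ n → Integrable (fun s : ℝ => s ^ n) T.ν)
    {ι : Type*} [DecidableEq ι] (f : ι → 𝓢(EuclideanSpace ℝ (Fin d), ℝ))
    (s : Finset ι) (a : ι) (ha : a ∉ s) (g : 𝓢(EuclideanSpace ℝ (Fin d), ℝ)) :
    expMoment P Z f (insert a s) g =
      ∑ B ∈ s.powerset, T.cumulant f (insert a B) g * expMoment P Z f (s \ B) g := by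
  have hG := hZ.isGeneralizedRandomField
  have hmom := hZ.integrable_abs_pow hb₁ hb
  have hE := fun {s : Finset ι} {a : ι} (ha : a ∉ s) g => hG.hasDerivAt_expMoment hmom f ha g
  have hC : ∀ {B : Finset ι} {a : ι} (_ : a ∉ B) g, HasDerivAt
      (fun t : ℝ => T.cumulant f B (g + t • f a)) (T.cumulant f (insert a B) g) 0 :=
    fun ha g => by
      simpa using LevyTriplet.hasDerivAt_cumulant hb (hZ.integrable_psiDeriv_zero hb₁ hb) f ha g 0
  -- The identity is needed at every `g`, since the inductive step differentiates it along `g + t •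
  -- f b`.
  induction s using Finset.induction_on generalizing a g with
  | empty =>
    have hexp : ∀ g, expMoment P Z f ∅ g = Complex.exp (T.cumulant f ∅ g) := fun g => by
      simpa [expMoment, LevyTriplet.cumulant, LevyTriplet.psi_eq_psiDeriv_zero hb₁ hb] using
        hZ.charFunctional_eq g
    have h1 := hE ha g
    simp only [hexp] at h1
    have h2 := h1.unique (hC ha g).cexp
    rw [h2]
    simp [hexp, mul_comm]
  | insert b s hb' ih =>
    rw [mem_insert, not_or] at ha
    obtain ⟨hab, has⟩ := ha
    have hbas : b ∉ insert a s := by simp [Ne.symm hab, hb']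
    have h1 := hE hbas g
    simp only [ih a has] at h1
    have h2 : HasDerivAt (fun t : ℝ => ∑ B ∈ s.powerset,
        T.cumulant f (insert a B) (g + t • f b) * expMoment P Z f (s \ B) (g + t • f b))
        (∑ B ∈ s.powerset, (T.cumulant f (insert b (insert a B)) g * expMoment P Z f (s \ B) g +
          T.cumulant f (insert a B) g * expMoment P Z f (insert b (s \ B)) g)) 0 := by
      refine HasDerivAt.fun_sum fun B hB => ?_
      have hBs : B ⊆ s := mem_powerset.1 hB
      have hbB : b ∉ insert a B := fun h => hbas (insert_subset_insert a hBs h)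
      have hbs : b ∉ s \ B := fun h => hb' (sdiff_subset h)
      simpa using (hC hbB g).fun_mul (hE hbs g)
    rw [Finset.insert_comm a b s, h1.unique h2, sum_powerset_insert hb', sum_add_distrib, add_comm]
    congr 1
    · refine sum_congr rfl fun B hB => ?_
      rw [insert_sdiff_of_notMem _ fun h => hb' (mem_powerset.1 hB h)]
    · refine sum_congr rfl fun B hB => ?_
      rw [Finset.insert_comm a b B, insert_sdiff_insert, sdiff_insert_of_notMem hb']

theorem integral_prod_eq_sum_finpartition (hZ : IsLevyNoiseField P Z T)
    (hb₁ : IntegrableOn (fun s : ℝ => s) {s : ℝ | 1 < |s|} T.ν)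
    (hb : ∀ n : ℕ, 2 ≤ n → Integrable (fun s : ℝ => s ^ n) T.ν)
    {ι : Type*} [DecidableEq ι] (f : ι → 𝓢(EuclideanSpace ℝ (Fin d), ℝ)) (s : Finset ι) :
    ∫ ω, ∏ j ∈ s, Z (f j) ω ∂P =
      ∑ I : Finpartition s, ∏ B ∈ I.parts, (T.c #B * ∫ x, ∏ j ∈ B, f j x) := by
  refine eq_sum_finpartition_of_recursion (fun B => T.c #B * ∫ x, ∏ j ∈ B, f j x)
    (fun s => ∫ ω, ∏ j ∈ s, Z (f j) ω ∂P) (by simp) (fun s a ha => ?_) s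
  have h := hZ.expMoment_insert hb₁ hb f s a ha 0
  rw [hZ.isGeneralizedRandomField.expMoment_zero] at h
  have hI : Complex.I ^ #(insert a s) ≠ 0 := pow_ne_zero _ Complex.I_ne_zero
  apply Complex.ofReal_injective
  -- The same power of `i` occurs in every term, because `#(insert a s) = #(insert a B) + #(s \ B)`.
  refine mul_left_cancel₀ hI (h.trans ?_)
  rw [Complex.ofReal_sum, mul_sum]
  refine sum_congr rfl fun B hB => ?_
  rw [mem_powerset] at hB
  rw [LevyTriplet.cumulant_zero f (insert_nonempty a B),
    hZ.isGeneralizedRandomField.expMoment_zero, Complex.ofReal_mul (_ * _), card_insert_of_notMem ha,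
    card_insert_of_notMem fun h => ha (hB h), ← card_sdiff_add_card_eq_card hB]
  ring

end IsLevyNoiseField

theorem proposition3p6 {d : ℕ} {Ω : Type*} [MeasurableSpace Ω] (P : Measure Ω)
    [IsProbabilityMeasure P] (T : LevyTriplet)
    (Z : 𝓢(EuclideanSpace ℝ (Fin d), ℝ) → Ω → ℝ)
    (hZ : IsLevyNoiseField P Z T) (hcont : IsTripleNormContinuous P Z)
    (hb₁ : IntegrableOn (fun s : ℝ => s) {s : ℝ | 1 < |s|} T.ν)
    (hb : ∀ n : ℕ, 2 ≤ n → Integrable (fun s : ℝ => s ^ n) T.ν) :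
    (∀ (f : 𝓢(EuclideanSpace ℝ (Fin d), ℝ)) (n : ℕ), Integrable (fun ω => |Z f ω| ^ n) P) ∧
    ∀ (n : ℕ) (f : Fin n → 𝓢(EuclideanSpace ℝ (Fin d), ℝ)),
      Integrable (fun ω => ∏ j, Z (f j) ω) P ∧
      ∫ ω, ∏ j, Z (f j) ω ∂P =
        ∑ I : Finpartition (Finset.univ : Finset (Fin n)),
          ∏ B ∈ I.parts, (T.c B.card * ∫ x, ∏ j ∈ B, f j x) := by
  have hmom := hZ.integrable_abs_pow hb₁ hb
  have hG := hZ.isGeneralizedRandomField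
  refine ⟨hmom, fun n f => ⟨?_, hZ.integral_prod_eq_sum_finpartition hb₁ hb f univ⟩⟩
  refine (hG.integrable_prod_abs hmom f univ).mono'
    (Finset.aemeasurable_fun_prod univ fun j _ => hG.aemeasurable (f j)).aestronglyMeasurable
    (ae_of_all _ fun ω => ?_)
  rw [Real.norm_eq_abs, abs_prod]
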